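/- Let $k\in\mathbb N\cup\{\infty\}$ (with $k=0$ allowed), let $U\subseteq\mathbb R$ be a nonempty open set, and let $A=C^k(U)$ be the ring of real-valued functions on $U$ with continuous derivatives up to and including order $k$ (of all orders if $k=\infty$; $C^0(U)$ is the ring of continuous functions). Let $Q_{\mathrm{cl}}(A)$ be the classical ring of quotients, i.e. the localization of $A$ at its set of non-zero-divisors; let $Q(A)=\varinjlim_D \operatorname{Hom}_A(D,A)$ be the complete ring of quotients, where $D$ ranges over the dense ideals of $A$ (the ideals with zero annihilator), the product being induced by composition; and let $Q_{\mathrm{tot}}(A)$ be the maximal flat epimorphic extension of $A$, i.e. an injective flat ring epimorphism $A\to Q_{\mathrm{tot}}(A)$ such that for every injective flat ring epimorphism $A\to B$ there is a unique ring homomorphism $B\to Q_{\mathrm{tot}}(A)$ compatible with the maps from $A$ (epimorphisms are taken in the category of all unital rings). Then $$Q_{\mathrm{cl}}(A)=Q(A)=Q_{\mathrm{tot}}(A)$$ as extensions of $A$: $Q_{\mathrm{cl}}(A)$ and $Q(A)$ are isomorphic as $A$-algebras, and each of them, with its canonical map from $A$, has the universal property of $Q_{\mathrm{tot}}(A)$.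 Moreover, this ring is von Neumann regular: each of its elements $a$ has the form $a=axa$ for some element $x$ of the ring. -/

import Mathlib

universe u

/-! ### The ring `C^k(U)` -/

/-- `C^k(U)`: the ring of functions `U → ℝ` of class `C^k` (meant for open `U`), under the pointwise
operations. A function belongs to it if it is the restriction to `U` of some `F : ℝ → ℝ`
that is `C^k` on `U`; the values of `F` off `U` are irrelevant. Here `k = ⊤` in `ℕ∞` means
smooth, that is, having derivatives of all orders. -/
def CkRing (k : ℕ∞) (U : Set ℝ) : Subring (U → ℝ) where
  carrier := {f | ∃ F : ℝ → ℝ, ContDiffOn ℝ (k : WithTop ℕ∞) F U ∧ ∀ x : U, f x = F x}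
  mul_mem' := by
    rintro f g ⟨F, hF, hf⟩ ⟨G, hG, hg⟩
    exact ⟨fun x => F x * G x, hF.mul hG, fun x => by simp [hf, hg]⟩
  one_mem' := ⟨fun _ => 1, contDiffOn_const, fun _ => rfl⟩
  add_mem' := by
    rintro f g ⟨F, hF, hf⟩ ⟨G, hG, hg⟩
    exact ⟨fun x => F x + G x, hF.add hG, fun x => by simp [hf, hg]⟩
  zero_mem' := ⟨fun _ => 0, contDiffOn_const, fun _ => rfl⟩
  neg_mem' := by
    rintro f ⟨F, hF, hf⟩
    exact ⟨fun x => - F x, hF.neg, fun x => by simp [hf]⟩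

/-! ### Von Neumann regular rings -/

/-- A ring is (von Neumann) regular if every `a` has the form `a * x * a`. -/
def IsVonNeumannRegular (R : Type*) [Ring R] : Prop :=
  ∀ a : R, ∃ x : R, a = a * x * a

/-! ### The complete ring of quotients

It is the direct limit of `Hom_A(D, A)` over the dense ideals `D` of `A`, ordered by reverse
inclusion, with the product induced by composition. -/

/-- An ideal is dense if its annihilator is zero. -/
def IsDenseIdeal {A : Type*} [CommRing A] (D : Ideal A) : Prop :=
  ∀ a : A, (∀ d ∈ D, a * d = 0) → a = 0

namespace IsDenseIdeal

variable {A : Type*} [CommRing A]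

theorem top : IsDenseIdeal (⊤ : Ideal A) := fun a h => by
  simpa using h 1 trivial

theorem mono {D E : Ideal A} (hD : IsDenseIdeal D) (h : D ≤ E) : IsDenseIdeal E :=
  fun a ha => hD a fun d hd => ha d (h hd)

theorem mul {D E : Ideal A} (hD : IsDenseIdeal D) (hE : IsDenseIdeal E) :
    IsDenseIdeal (D * E) := fun a ha =>
  hD a fun d hd => hE _ fun e he => by
    rw [mul_assoc]
    exact ha _ (Ideal.mul_mem_mul hd he)

theorem inf {D E : Ideal A} (hD : IsDenseIdeal D) (hE : IsDenseIdeal E) :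
    IsDenseIdeal (D ⊓ E) :=
  (hD.mul hE).mono Ideal.mul_le_inf

end IsDenseIdeal

/-- A homomorphism of `A`-modules `D → A` whose domain `D` is some dense ideal of `A`. -/
structure DenseHom (A : Type*) [CommRing A] where
  /-- the domain of definition -/
  dom : Ideal A
  dense : IsDenseIdeal dom
  /-- the homomorphism -/
  hom : dom →ₗ[A] A

namespace DenseHom

variable {A : Type*} [CommRing A]

/-- Two homomorphisms are identified in the direct limit if they agree on a dense ideal contained
in both domains. -/
def Rel (f g : DenseHom A) : Prop :=
  ∃ D : Ideal A, IsDenseIdeal D ∧ ∃ (hf : D ≤ f.dom) (hg : D ≤ g.dom),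
    ∀ (x : A) (hx : x ∈ D), f.hom ⟨x, hf hx⟩ = g.hom ⟨x, hg hx⟩

theorem rel_of_forall {f g : DenseHom A}
    (h : ∀ (x : A) (hf : x ∈ f.dom) (hg : x ∈ g.dom), f.hom ⟨x, hf⟩ = g.hom ⟨x, hg⟩) :
    Rel f g :=
  ⟨f.dom ⊓ g.dom, f.dense.inf g.dense, inf_le_left, inf_le_right, fun x hx => h x hx.1 hx.2⟩

/-- The direct limit as a quotient of the set of all homomorphisms on dense ideals. -/
instance setoid (A : Type*) [CommRing A] : Setoid (DenseHom A) where
  r := Rel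
  iseqv :=
    { refl := fun _ => rel_of_forall fun _ _ _ => rfl
      symm := by
        rintro f g ⟨D, hD, hf, hg, h⟩
        exact ⟨D, hD, hg, hf, fun x hx => (h x hx).symm⟩
      trans := by
        rintro f g h ⟨D, hD, hf, hg, H⟩ ⟨E, hE, hg', hh, K⟩
        exact ⟨D ⊓ E, hD.inf hE, inf_le_left.trans hf, inf_le_right.trans hh,
          fun x hx => (H x hx.1).trans (K x hx.2)⟩ }

/-- Multiplication by `a`, defined on all of `A`. -/
def const (a : A) : DenseHom A where
  dom := ⊤
  dense := IsDenseIdeal.top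
  hom := a • (⊤ : Ideal A).subtype

/-- The sum, defined on the intersection of the domains. -/
def add (f g : DenseHom A) : DenseHom A where
  dom := f.dom ⊓ g.dom
  dense := f.dense.inf g.dense
  hom := f.hom.comp (Submodule.inclusion inf_le_left) +
    g.hom.comp (Submodule.inclusion inf_le_right)

/-- The negative. -/
def neg (f : DenseHom A) : DenseHom A where
  dom := f.dom
  dense := f.dense
  hom := -f.hom

theorem hom_mul_left (f : DenseHom A) (a : A) {b : A} (hb : b ∈ f.dom) (hab : a * b ∈ f.dom) :
    f.hom ⟨a * b, hab⟩ = a * f.hom ⟨b, hb⟩ :=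
  f.hom.map_smul a ⟨b, hb⟩

theorem hom_mul_right (f : DenseHom A) {a : A} (b : A) (ha : a ∈ f.dom) (hab : a * b ∈ f.dom) :
    f.hom ⟨a * b, hab⟩ = b * f.hom ⟨a, ha⟩ := by
  rw [← f.hom_mul_left b ha (f.dom.mul_mem_left b ha)]
  exact congrArg f.hom (Subtype.ext (mul_comm a b))

theorem hom_add (f : DenseHom A) {a b : A} (ha : a ∈ f.dom) (hb : b ∈ f.dom)
    (hab : a + b ∈ f.dom) : f.hom ⟨a + b, hab⟩ = f.hom ⟨a, ha⟩ + f.hom ⟨b, hb⟩ :=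
  f.hom.map_add ⟨a, ha⟩ ⟨b, hb⟩

/-- The domain of `f ∘ g`: all `x` in the domain of `g` such that `g x` is in the domain of `f`. -/
def compDom (f g : DenseHom A) : Ideal A where
  carrier := {x | ∃ h : x ∈ g.dom, g.hom ⟨x, h⟩ ∈ f.dom}
  add_mem' := by
    rintro a b ⟨ha, ha'⟩ ⟨hb, hb'⟩
    refine ⟨add_mem ha hb, ?_⟩
    rw [g.hom_add ha hb]
    exact add_mem ha' hb'
  zero_mem' := by
    refine ⟨g.dom.zero_mem, ?_⟩
    have : (⟨0, g.dom.zero_mem⟩ : g.dom) = 0 := rfl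
    rw [this, map_zero]
    exact f.dom.zero_mem
  smul_mem' := by
    rintro a b ⟨hb, hb'⟩
    refine ⟨g.dom.mul_mem_left a hb, ?_⟩
    have : g.hom ⟨a * b, g.dom.mul_mem_left a hb⟩ ∈ f.dom := by
      rw [g.hom_mul_left a hb]
      exact f.dom.mul_mem_left a hb'
    exact this

theorem mem_compDom {f g : DenseHom A} {x : A} :
    x ∈ compDom f g ↔ ∃ h : x ∈ g.dom, g.hom ⟨x, h⟩ ∈ f.dom := Iff.rfl

theorem mul_le_compDom (f g : DenseHom A) : f.dom * g.dom ≤ compDom f g :=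
  Ideal.mul_le.2 fun a ha b hb => by
    refine ⟨g.dom.mul_mem_left a hb, ?_⟩
    rw [g.hom_mul_left a hb]
    exact f.dom.mul_mem_right _ ha

/-- The composite `f ∘ g`, with its natural domain. -/
def comp (f g : DenseHom A) : DenseHom A where
  dom := compDom f g
  dense := (f.dense.mul g.dense).mono (mul_le_compDom f g)
  hom :=
    { toFun := fun x => f.hom ⟨g.hom ⟨x, (mem_compDom.1 x.2).1⟩, (mem_compDom.1 x.2).2⟩
      map_add' := fun x y => by
        rw [← map_add]
        exact congrArg f.hom (Subtype.ext (g.hom_add _ _ _))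
      map_smul' := fun a x => by
        rw [RingHom.id_apply, ← map_smul]
        exact congrArg f.hom (Subtype.ext (g.hom_mul_left a _ _)) }

theorem mem_comp {f g : DenseHom A} {x : A} :
    x ∈ (comp f g).dom ↔ ∃ h : x ∈ g.dom, g.hom ⟨x, h⟩ ∈ f.dom := Iff.rfl

theorem comp_congr {f f' g g' : DenseHom A} (hf : Rel f f') (hg : Rel g g') :
    Rel (comp f g) (comp f' g') := by
  obtain ⟨D, hD, h₁, h₂, h⟩ := hf
  obtain ⟨E, hE, k₁, k₂, k⟩ := hg
  have key : ∀ x ∈ D * E, ∃ hx : x ∈ E, g.hom ⟨x, k₁ hx⟩ ∈ D := fun x hx => by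
    refine Submodule.mul_induction_on hx (fun a ha b hb => ?_) ?_
    · refine ⟨E.mul_mem_left a hb, ?_⟩
      rw [g.hom_mul_left a (k₁ hb)]
      exact D.mul_mem_right _ ha
    · rintro x y ⟨hx, hx'⟩ ⟨hy, hy'⟩
      refine ⟨E.add_mem hx hy, ?_⟩
      rw [g.hom_add (k₁ hx) (k₁ hy)]
      exact D.add_mem hx' hy'
  refine ⟨D * E, hD.mul hE, fun x hx => ?_, fun x hx => ?_, fun x hx => ?_⟩
  · obtain ⟨hE, hx'⟩ := key x hx
    exact mem_comp.2 ⟨k₁ hE, h₁ hx'⟩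
  · obtain ⟨hE, hx'⟩ := key x hx
    exact mem_comp.2 ⟨k₂ hE, h₂ (k x hE ▸ hx')⟩
  · obtain ⟨hE, hx'⟩ := key x hx
    change f.hom ⟨g.hom ⟨x, k₁ hE⟩, h₁ hx'⟩ = f'.hom ⟨g'.hom ⟨x, k₂ hE⟩, _⟩
    rw [h _ hx']
    congr 1
    exact Subtype.ext (k x hE)

theorem comp_comm (f g : DenseHom A) : Rel (comp f g) (comp g f) := by
  have le : f.dom * g.dom ≤ compDom g f := mul_comm g.dom f.dom ▸ mul_le_compDom g f
  refine ⟨f.dom * g.dom, f.dense.mul g.dense, mul_le_compDom f g, le, fun x hx => ?_⟩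
  have : ∃ (h : x ∈ (comp f g).dom) (h' : x ∈ (comp g f).dom),
      (comp f g).hom ⟨x, h⟩ = (comp g f).hom ⟨x, h'⟩ := by
    refine Submodule.mul_induction_on hx (fun a ha b hb => ?_) ?_
    · have hab := Ideal.mul_mem_mul ha hb
      refine ⟨mul_le_compDom f g hab, le hab, ?_⟩
      have s : (comp f g).hom ⟨a * b, mul_le_compDom f g hab⟩ = g.hom ⟨b, hb⟩ * f.hom ⟨a, ha⟩ :=
        (congrArg f.hom (Subtype.ext (g.hom_mul_left a hb _))).trans
          (f.hom_mul_right _ ha (f.dom.mul_mem_right _ ha))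
      have s' : (comp g f).hom ⟨a * b, le hab⟩ = g.hom ⟨b, hb⟩ * f.hom ⟨a, ha⟩ :=
        (congrArg g.hom (Subtype.ext ((f.hom_mul_right b ha _).trans (mul_comm _ _)))).trans
          ((g.hom_mul_left _ hb (g.dom.mul_mem_left _ hb)).trans (mul_comm _ _))
      rw [s, s']
    · rintro x y ⟨h₁, h₁', e₁⟩ ⟨h₂, h₂', e₂⟩
      refine ⟨add_mem h₁ h₂, add_mem h₁' h₂', ?_⟩
      rw [hom_add _ h₁ h₂, hom_add _ h₁' h₂', e₁, e₂]
  obtain ⟨_, _, e⟩ := this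
  exact e

end DenseHom

/-- The complete (maximal) ring of quotients `Q(A)` of a commutative ring `A`: the direct limit of
the modules `Hom_A(D, A)`, where `D` runs through the dense ideals of `A`. -/
def CompleteQuotientRing (A : Type*) [CommRing A] : Type _ :=
  Quotient (DenseHom.setoid A)

namespace CompleteQuotientRing

variable {A : Type*} [CommRing A]

/-- The class of a homomorphism defined on a dense ideal. -/
def mk (f : DenseHom A) : CompleteQuotientRing A := Quotient.mk _ f

theorem mk_eq_mk {f g : DenseHom A} : mk f = mk g ↔ DenseHom.Rel f g := Quotient.eq

instance : Zero (CompleteQuotientRing A) := ⟨mk (DenseHom.const 0)⟩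

instance : One (CompleteQuotientRing A) := ⟨mk (DenseHom.const 1)⟩

instance : Add (CompleteQuotientRing A) :=
  ⟨Quotient.map₂ DenseHom.add <| by
    rintro f f' ⟨D, hD, h₁, h₂, h⟩ g g' ⟨E, hE, k₁, k₂, k⟩
    exact ⟨D ⊓ E, hD.inf hE, inf_le_inf h₁ k₁, inf_le_inf h₂ k₂,
      fun x hx => congrArg₂ (· + ·) (h x hx.1) (k x hx.2)⟩⟩

instance : Neg (CompleteQuotientRing A) :=
  ⟨Quotient.map DenseHom.neg <| by
    rintro f f' ⟨D, hD, h₁, h₂, h⟩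
    exact ⟨D, hD, h₁, h₂, fun x hx => congrArg (- ·) (h x hx)⟩⟩

instance : Mul (CompleteQuotientRing A) :=
  ⟨Quotient.map₂ DenseHom.comp fun _ _ hf _ _ hg => DenseHom.comp_congr hf hg⟩

/-- Addition is induced by addition of homomorphisms, multiplication by composition, and `0` and
`1` are the classes of multiplication by `0` and by `1`. -/
instance (A : Type*) [CommRing A] : CommRing (CompleteQuotientRing A) where
  nsmul := nsmulRec
  zsmul := zsmulRec
  add_assoc := by
    rintro ⟨f⟩ ⟨g⟩ ⟨h⟩
    exact mk_eq_mk.2 (DenseHom.rel_of_forall fun x _ _ => add_assoc _ _ _)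
  zero_add := by
    rintro ⟨f⟩
    refine mk_eq_mk.2 (DenseHom.rel_of_forall fun x _ hx => ?_)
    change 0 * x + f.hom ⟨x, hx⟩ = f.hom ⟨x, hx⟩
    rw [zero_mul, zero_add]
  add_zero := by
    rintro ⟨f⟩
    refine mk_eq_mk.2 (DenseHom.rel_of_forall fun x _ hx => ?_)
    change f.hom ⟨x, hx⟩ + 0 * x = f.hom ⟨x, hx⟩
    rw [zero_mul, add_zero]
  add_comm := by
    rintro ⟨f⟩ ⟨g⟩
    exact mk_eq_mk.2 (DenseHom.rel_of_forall fun x _ _ => add_comm _ _)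
  neg_add_cancel := by
    rintro ⟨f⟩
    refine mk_eq_mk.2 (DenseHom.rel_of_forall fun x hx _ => ?_)
    change -f.hom ⟨x, _⟩ + f.hom ⟨x, _⟩ = 0 * x
    rw [zero_mul, neg_add_cancel]
  mul_assoc := by
    rintro ⟨f⟩ ⟨g⟩ ⟨h⟩
    exact mk_eq_mk.2 (DenseHom.rel_of_forall fun x _ _ => rfl)
  one_mul := by
    rintro ⟨f⟩
    refine mk_eq_mk.2 (DenseHom.rel_of_forall fun x _ hx => ?_)
    change 1 * f.hom ⟨x, hx⟩ = f.hom ⟨x, hx⟩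
    rw [one_mul]
  mul_one := by
    rintro ⟨f⟩
    refine mk_eq_mk.2 (DenseHom.rel_of_forall fun x hx' hx => ?_)
    change f.hom ⟨1 * x, _⟩ = f.hom ⟨x, hx⟩
    congr 1
    exact Subtype.ext (one_mul x)
  left_distrib := by
    rintro ⟨f⟩ ⟨g⟩ ⟨h⟩
    refine mk_eq_mk.2 (DenseHom.rel_of_forall fun x hx hx' => ?_)
    obtain ⟨h₁, h₁'⟩ := DenseHom.mem_comp.1 hx'.1
    obtain ⟨h₂, h₂'⟩ := DenseHom.mem_comp.1 hx'.2
    exact f.hom.map_add ⟨g.hom ⟨x, h₁⟩, h₁'⟩ ⟨h.hom ⟨x, h₂⟩, h₂'⟩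
  right_distrib := by
    rintro ⟨f⟩ ⟨g⟩ ⟨h⟩
    exact mk_eq_mk.2 (DenseHom.rel_of_forall fun x _ _ => rfl)
  zero_mul := by
    rintro ⟨f⟩
    refine mk_eq_mk.2 (DenseHom.rel_of_forall fun x hx _ => ?_)
    obtain ⟨h, -⟩ := DenseHom.mem_comp.1 hx
    change 0 * f.hom ⟨x, h⟩ = 0 * x
    rw [zero_mul, zero_mul]
  mul_zero := by
    rintro ⟨f⟩
    refine mk_eq_mk.2 (DenseHom.rel_of_forall fun x hx _ => ?_)
    have h := (DenseHom.mem_comp.1 hx).2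
    have : (⟨_, h⟩ : f.dom) = 0 := Subtype.ext (zero_mul x)
    change f.hom ⟨_, h⟩ = 0 * x
    rw [this, map_zero, zero_mul]
  mul_comm := by
    rintro ⟨f⟩ ⟨g⟩
    exact mk_eq_mk.2 (DenseHom.comp_comm f g)

theorem mk_add (f g : DenseHom A) : mk f + mk g = mk (f.add g) := rfl

theorem mk_mul (f g : DenseHom A) : mk f * mk g = mk (f.comp g) := rfl

/-- The canonical map `A → Q(A)` sends `a` to the class of multiplication by `a`. -/
instance (A : Type*) [CommRing A] : Algebra A (CompleteQuotientRing A) :=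
  RingHom.toAlgebra
    { toFun := fun a => mk (DenseHom.const a)
      map_one' := rfl
      map_zero' := rfl
      map_add' := fun a b => mk_eq_mk.2 (DenseHom.rel_of_forall fun x _ _ => add_mul a b x)
      map_mul' := fun a b => mk_eq_mk.2 (DenseHom.rel_of_forall fun x _ _ => mul_assoc a b x) }

end CompleteQuotientRing

/-! ### The maximal flat epimorphic extension -/

/-- An extension `α : A → B` of a commutative ring `A` is a flat epimorphic extension if `α` is
injective, makes `B` a flat `A`-module, and is an epimorphism in the category of all rings. The ring
`B` and the test rings for epimorphisms need not be commutative. -/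
structure IsFlatEpimorphicExtension {A B : Type u} [CommRing A] [Ring B] (α : A →+* B) :
    Prop where
  injective : Function.Injective α
  flat : @Module.Flat A B _ _ (Module.compHom B α)
  epi : CategoryTheory.Epi (RingCat.ofHom α)

/-- `φ : A → M` is the maximal flat epimorphic extension `Q_tot(A)` of `A`: it is a flat epimorphic
extension, and every flat epimorphic extension of `A` maps to it uniquely under `A`. This
determines `φ` up to a unique isomorphism under `A`. Rings in the universe of `A` suffice, as
the cardinality of an epimorphic extension of `A` is at most that of `A` or countable. -/
structure IsMaximalFlatEpimorphicExtension {A M : Type u} [CommRing A] [Ring M] (φ : A →+* M) :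
    Prop where
  isFlatEpimorphicExtension : IsFlatEpimorphicExtension φ
  existsUnique_lift : ∀ (B : Type u) [Ring B] (α : A →+* B), IsFlatEpimorphicExtension α →
    ∃! β : B →+* M, β.comp α = φ

/-! Two properties of `A = C^k(U)` carry the proof; the rest is algebra. Complements
(`CkRing.exists_complement`): for each `f` some `g` is nonzero exactly off the closure of `{f ≠ 0}`.
Then `f * g = 0` and `f + g` is a non-zero-divisor, so `Q_cl(A)` is von Neumann regular. Fractions
(`CkRing.exists_fraction`): for `φ : D → A` with `D` dense, `d * φ e = e * φ d`. With cutoffs `χₙ`,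
elements `dₙ` of `D` and small weights `rₙ`, put `q = ∑ rₙ χₙ dₙ²` and `p = ∑ rₙ χₙ dₙ φ(dₙ)`; then
`q * φ d = p * d`. By Lindelöf, countably many `dₙ` make `q` positive wherever some element of `D`
is nonzero, so `q` is a non-zero-divisor and `Q(A) = Q_cl(A)`. Finally, let `K` be a regular total
ring of fractions of `A`, and `B` a flat epimorphic extension. Then `K → K ⊗ B` is faithfully flat
and an epimorphism, hence bijective, and `B → K ⊗ B ≃ K` is the required map. -/

open CategoryTheory TensorProduct

/-! ### Ring epimorphisms -/

theorem RingHom.eq_of_comp_eq_of_epi {A B : Type u} [Ring A] [Ring B] {α : A →+* B}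
    (hα : Epi (RingCat.ofHom α)) {R : Type u} [Ring R] {f g : B →+* R}
    (h : f.comp α = g.comp α) : f = g := by
  have h' : RingCat.ofHom α ≫ RingCat.ofHom f = RingCat.ofHom α ≫ RingCat.ofHom g := by
    rw [← RingCat.ofHom_comp, ← RingCat.ofHom_comp, h]
  exact congrArg RingCat.Hom.hom (hα.left_cancellation _ _ h')

/-- An element commuting with the image of an epimorphism is central: conjugation by
`!![1, b; 0, 1]` fixes the diagonal copy of the image, hence that of the whole ring. -/
theorem RingHom.commute_of_epi {A B : Type u} [Ring A] [Ring B] {α : A →+* B}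
    (hα : Epi (RingCat.ofHom α)) {b : B} (hb : ∀ a, Commute b (α a)) (x : B) : Commute b x := by
  let f : B →+* Matrix (Fin 2) (Fin 2) B := Matrix.scalar (Fin 2)
  let g : B →+* Matrix (Fin 2) (Fin 2) B :=
    { toFun x := !![x, b * x - x * b; 0, x]
      map_one' := by ext i j; fin_cases i <;> fin_cases j <;> simp
      map_zero' := by ext i j; fin_cases i <;> fin_cases j <;> simp
      map_add' x y := by
        ext i j; fin_cases i <;> fin_cases j <;> simp [mul_add, add_mul]; abel
      map_mul' x y := by
        ext i j; fin_cases i <;> fin_cases j <;> simp [Matrix.mul_apply, mul_sub, sub_mul, mul_assoc] }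
  have hfg : f = g := by
    refine RingHom.eq_of_comp_eq_of_epi hα (RingHom.ext fun a => ?_)
    ext i j
    fin_cases i <;> fin_cases j <;> simp [f, g, (hb a).eq]
  have := congrFun (congrFun (RingHom.congr_fun hfg x) 0) 1
  simp [f, g] at this
  exact (sub_eq_zero.1 this.symm)

/-- The target of an epimorphism of rings with commutative source is commutative. -/
theorem RingHom.mul_comm_of_epi {A B : Type u} [CommRing A] [Ring B] {α : A →+* B}
    (hα : Epi (RingCat.ofHom α)) (x y : B) : x * y = y * x :=
  (RingHom.commute_of_epi hα (fun a => (RingHom.commute_of_epi hα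
    (fun a' => by rw [Commute, SemiconjBy, ← map_mul, mul_comm, map_mul]) x).symm) y).eq

/-! ### Regular rings and flat epimorphic extensions -/

/-- Since `x * (1 - y * x) = 0`, a smaller prime missing some `x ∈ p` would contain `1 - y * x`,
forcing `1 ∈ p`. -/
theorem IsVonNeumannRegular.minimalPrimes {K : Type*} [CommRing K] (hK : IsVonNeumannRegular K)
    (p : Ideal K) [hp : p.IsPrime] : p ∈ minimalPrimes K := by
  refine ⟨⟨hp, bot_le⟩, fun q hq hqp x hx => ?_⟩
  have := hq.1
  obtain ⟨y, hy⟩ := hK x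
  have h : x * (1 - y * x) ∈ q := by
    have : x * (1 - y * x) = 0 := by linear_combination hy
    rw [this]; exact q.zero_mem
  refine (this.mem_or_mem h).resolve_right fun h' => hp.ne_top ((Ideal.eq_top_iff_one p).2 ?_)
  have := p.add_mem (hqp h') (p.mul_mem_left y hx)
  simpa using this

/-- A flat extension of a commutative von Neumann regular ring is faithfully flat. -/
theorem IsVonNeumannRegular.faithfullyFlat {K C : Type*} [CommRing K] [CommRing C] [Algebra K C]
    (hK : IsVonNeumannRegular K) [Module.Flat K C]
    (h : Function.Injective (algebraMap K C)) : Module.FaithfullyFlat K C := by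
  refine Module.FaithfullyFlat.of_comap_surjective fun p => ?_
  -- Minimal primes lift along any injective ring map, and here every prime is minimal.
  obtain ⟨q, hq, e⟩ := Ideal.exists_comap_eq_of_mem_minimalPrimes_of_injective h p.asIdeal
    (hK.minimalPrimes p.asIdeal)
  exact ⟨⟨q, hq⟩, PrimeSpectrum.ext e⟩

/-- A von Neumann regular flat algebra over `A` receives a map from each flat epimorphic extension
of `A`. -/
theorem IsFlatEpimorphicExtension.exists_lift {A B K : Type u} [CommRing A] [CommRing K]
    [Algebra A K] [Module.Flat A K] (hK : IsVonNeumannRegular K) [Ring B]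
    {α : A →+* B} (hα : IsFlatEpimorphicExtension α) :
    ∃ β : B →+* K, β.comp α = algebraMap A K := by
  let _ : CommRing B := { ‹Ring B› with mul_comm := RingHom.mul_comm_of_epi hα.epi }
  let _ : Algebra A B := α.toAlgebra
  have : Module.Flat A B := hα.flat
  have hinj : Function.Injective (algebraMap K (K ⊗[A] B)) :=
    Algebra.TensorProduct.includeLeft_injective (S := K) hα.injective
  have := hK.faithfullyFlat hinj
  have hsurj : Function.Surjective (algebraMap K (K ⊗[A] B)) := by
    -- By faithfully flat descent it suffices that `C → C ⊗[K] C` is onto, where `C = K ⊗[A] B`. The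
    -- two inclusions `l`, `r` agree on `A`, hence on `B` and on `C`, so `x ⊗ y = l x * r y = l (x *
    -- y)`.
    refine Module.FaithfullyFlat.surjective_of_tensorProduct (S := K ⊗[A] B) ?_
    let i : B →+* K ⊗[A] B := (Algebra.TensorProduct.includeRight : B →ₐ[A] K ⊗[A] B).toRingHom
    have hi (a : A) : i (α a) = algebraMap K (K ⊗[A] B) (algebraMap A K a) :=
      (Algebra.TensorProduct.includeRight : B →ₐ[A] K ⊗[A] B).commutes a
    let l : (K ⊗[A] B) →ₐ[K] (K ⊗[A] B) ⊗[K] (K ⊗[A] B) := Algebra.TensorProduct.includeLeft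
    let r : (K ⊗[A] B) →ₐ[K] (K ⊗[A] B) ⊗[K] (K ⊗[A] B) := Algebra.TensorProduct.includeRight
    have hlr : l.toRingHom.comp i = r.toRingHom.comp i := by
      refine RingHom.eq_of_comp_eq_of_epi hα.epi (RingHom.ext fun a => ?_)
      change l (i (α a)) = r (i (α a))
      rw [hi, l.commutes, r.commutes]
    have hlr' : ∀ c, l c = r c := fun c => by
      induction c with
      | zero => simp
      | add x y hx hy => rw [map_add, map_add, hx, hy]
      | tmul k b =>
        have : k ⊗ₜ[A] b = k • i b := by simp [i, smul_tmul']
        rw [this, map_smul, map_smul]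
        exact congrArg (k • ·) (RingHom.congr_fun hlr b)
    intro z
    induction z with
    | zero => exact ⟨0, map_zero _⟩
    | add x y hx hy =>
      obtain ⟨x, rfl⟩ := hx
      obtain ⟨y, rfl⟩ := hy
      exact ⟨x + y, map_add _ _ _⟩
    | tmul x y =>
      refine ⟨x * y, ?_⟩
      have : x ⊗ₜ[K] y = l x * r y := by simp [l, r]
      rw [this, ← hlr', ← map_mul]
      rfl
  let e : K ≃+* K ⊗[A] B := RingEquiv.ofBijective _ ⟨hinj, hsurj⟩
  refine ⟨e.symm.toRingHom.comp
    (Algebra.TensorProduct.includeRight : B →ₐ[A] K ⊗[A] B).toRingHom, RingHom.ext fun a => ?_⟩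
  change e.symm ((Algebra.TensorProduct.includeRight : B →ₐ[A] K ⊗[A] B) (algebraMap A B a)) = _
  rw [AlgHom.commutes, RingEquiv.symm_apply_eq]
  rfl

/-- Denominators map to units, which can be cancelled on the right even in a noncommutative target.
-/
theorem IsLocalization.epi_ringCat {A K : Type u} [CommRing A] [CommRing K] [Algebra A K]
    (M : Submonoid A) [IsLocalization M K] : Epi (RingCat.ofHom (algebraMap A K)) := by
  refine ⟨fun {R} f g h => ?_⟩
  have h' (a : A) : f.hom (algebraMap A K a) = g.hom (algebraMap A K a) :=
    RingHom.congr_fun (congrArg RingCat.Hom.hom h) a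
  ext x
  obtain ⟨a, s, rfl⟩ := IsLocalization.exists_mk'_eq M x
  have hu : IsUnit (f.hom (algebraMap A K s)) := (IsLocalization.map_units K s).map f.hom
  refine hu.mul_right_cancel ?_
  change f.hom _ * _ = g.hom _ * _
  rw [← map_mul, IsLocalization.mk'_spec, h', h', ← map_mul, IsLocalization.mk'_spec]

theorem isMaximalFlatEpimorphicExtension_of_isVonNeumannRegular {A K : Type u} [CommRing A]
    [CommRing K] [Algebra A K] [IsFractionRing A K] (hK : IsVonNeumannRegular K) :
    IsMaximalFlatEpimorphicExtension (algebraMap A K) := by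
  have flat : Module.Flat A K := IsLocalization.flat K (nonZeroDivisors A)
  refine ⟨⟨IsFractionRing.injective A K, ?_, IsLocalization.epi_ringCat (nonZeroDivisors A)⟩,
    fun B _ α hα => ?_⟩
  · convert flat
    exact Module.ext' _ _ fun a x => (Algebra.smul_def a x).symm
  · obtain ⟨β, hβ⟩ := hα.exists_lift hK
    exact ⟨β, hβ, fun γ hγ => RingHom.eq_of_comp_eq_of_epi hα.epi (hγ.trans hβ.symm)⟩

/-! ### Regularity of total rings of fractions -/

/-- The total ring of fractions is von Neumann regular if each `a` has a complement: some `b` with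
`a * b = 0` and `a + b` a non-zero-divisor. -/
theorem IsFractionRing.isVonNeumannRegular {A K : Type*} [CommRing A] [CommRing K] [Algebra A K]
    [IsFractionRing A K] (h : ∀ a : A, ∃ b, a * b = 0 ∧ a + b ∈ nonZeroDivisors A) :
    IsVonNeumannRegular K := by
  intro x
  obtain ⟨a, s, rfl⟩ := IsLocalization.exists_mk'_eq (nonZeroDivisors A) x
  obtain ⟨b, hab, hr⟩ := h a
  -- For `a / s` take `s / (a + b)`: the identity reduces to `a * (a + b) = a * a`.
  refine ⟨IsLocalization.mk' K (s : A) (⟨a + b, hr⟩ : nonZeroDivisors A), ?_⟩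
  rw [← IsLocalization.mk'_mul, ← IsLocalization.mk'_mul, IsLocalization.mk'_eq_iff_eq]
  congr 1
  simp only [Submonoid.coe_mul]
  linear_combination (s : A) * s * hab

/-! ### Fractions in the complete ring of quotients -/

namespace CompleteQuotientRing

variable {A : Type*} [CommRing A]

theorem algebraMap_injective : Function.Injective (algebraMap A (CompleteQuotientRing A)) := by
  intro a b hab
  obtain ⟨D, hD, hf, hg, h⟩ := mk_eq_mk.1 hab
  exact sub_eq_zero.1 (hD _ fun d hd => by
    have : a * d = b * d := h d hd
    rw [sub_mul, this, sub_self])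

/-- Non-zero-divisors of `A` are invertible in `Q(A)`: the inverse of `s` is `s * a ↦ a`. -/
theorem isUnit_algebraMap (s : nonZeroDivisors A) :
    IsUnit (algebraMap A (CompleteQuotientRing A) s) := by
  have hinj : Function.Injective (LinearMap.mulRight A (s : A)) := fun a b hab =>
    (mul_cancel_right_mem_nonZeroDivisors s.2).1 hab
  let e := LinearEquiv.ofInjective _ hinj
  let g : DenseHom A :=
    { dom := LinearMap.range (LinearMap.mulRight A (s : A))
      dense := fun a ha => (mul_right_mem_nonZeroDivisors_eq_zero_iff s.2).1
        (ha _ ⟨1, one_mul _⟩)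
      hom := e.symm }
  refine IsUnit.of_mul_eq_one (mk g) (mk_eq_mk.2 (DenseHom.rel_of_forall fun x hx _ => ?_))
  obtain ⟨h, -⟩ := DenseHom.mem_comp.1 hx
  obtain ⟨a, rfl⟩ := h
  change (s : A) * e.symm (e a) = 1 * (a * s)
  rw [e.symm_apply_apply]
  ring

theorem isFractionRing (h : ∀ f : DenseHom A, ∃ q ∈ nonZeroDivisors A, ∃ p : A,
    ∀ (d : A) (hd : d ∈ f.dom), q * f.hom ⟨d, hd⟩ = p * d) :
    IsFractionRing A (CompleteQuotientRing A) where
  map_units s := isUnit_algebraMap s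
  exists_of_eq hab := ⟨1, by rw [algebraMap_injective hab]⟩
  surj := by
    rintro ⟨f⟩
    obtain ⟨q, hq, p, hp⟩ := h f
    refine ⟨(p, ⟨q, hq⟩), ?_⟩
    refine (mul_comm _ _).trans (mk_eq_mk.2 (DenseHom.rel_of_forall fun x hx _ => ?_))
    obtain ⟨h, -⟩ := DenseHom.mem_comp.1 hx
    exact hp x h

end CompleteQuotientRing

/-! ### Weighted sums and cutoffs of `C^k` functions -/

open scoped ContDiff

/-- Compactly supported `C^k` functions can be scaled so that their sum is `C^k`. -/
theorem exists_pos_forall_contDiff_tsum {k : ℕ∞} {g : ℕ → ℝ → ℝ} (hg : ∀ n, ContDiff ℝ k (g n))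
    (hc : ∀ n, HasCompactSupport (g n)) : ∃ R : ℕ → ℝ, (∀ n, 0 < R n) ∧
      ∀ r : ℕ → ℝ, (∀ n, |r n| ≤ R n) → ContDiff ℝ k (fun x => ∑' n, r n * g n x) ∧
        ∀ x, Summable fun n => r n * g n x := by
  have bdd (n i : ℕ) : ∃ C : ℝ, (i : ℕ∞) ≤ k → ∀ x, ‖iteratedFDeriv ℝ i (g n) x‖ ≤ C := by
    by_cases hi : (i : ℕ∞) ≤ k
    · have : BddAbove (Set.range fun x => ‖iteratedFDeriv ℝ i (g n) x‖) := by
        apply ((hg n).continuous_iteratedFDeriv (mod_cast hi)).norm.bddAbove_range_of_hasCompactSupport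
        exact HasCompactSupport.comp_left ((hc n).iteratedFDeriv i) norm_zero
      obtain ⟨C, hC⟩ := this
      exact ⟨C, fun _ x => hC ⟨x, rfl⟩⟩
    · exact ⟨0, fun h => absurd h hi⟩
  choose C hC using bdd
  have hM (n : ℕ) : 0 < 1 + ∑ i ∈ Finset.range (n + 1), |C n i| :=
    add_pos_of_pos_of_nonneg one_pos (Finset.sum_nonneg fun _ _ => abs_nonneg _)
  -- The `n`-th weight controls only derivatives of order at most `n`. A fixed order `i` is thus
  -- controlled for all `n ≥ i`, which suffices for convergence, also when `k = ∞`.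
  refine ⟨fun n => (1 / 2) ^ n / (1 + ∑ i ∈ Finset.range (n + 1), |C n i|),
    fun n => div_pos (by positivity) (hM n), fun r hr => ?_⟩
  have hsum : Summable fun n : ℕ => (1 / 2 : ℝ) ^ n := summable_geometric_two
  have key (n i : ℕ) (hi : (i : ℕ∞) ≤ k) (hin : i ≤ n) (x : ℝ) :
      ‖iteratedFDeriv ℝ i (r n • g n) x‖ ≤ (1 / 2) ^ n := by
    rw [iteratedFDeriv_const_smul_apply ((hg n).contDiffAt.of_le (mod_cast hi)), norm_smul,
      Real.norm_eq_abs]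
    have h₁ : ‖iteratedFDeriv ℝ i (g n) x‖ ≤ 1 + ∑ i ∈ Finset.range (n + 1), |C n i| := by
      have := Finset.single_le_sum (f := fun i => |C n i|) (fun _ _ => abs_nonneg _)
        (Finset.mem_range.2 (Nat.lt_succ_of_le hin))
      linarith [hC n i hi x, le_abs_self (C n i)]
    calc |r n| * ‖iteratedFDeriv ℝ i (g n) x‖
        ≤ (1 / 2) ^ n / (1 + ∑ i ∈ Finset.range (n + 1), |C n i|) *
          (1 + ∑ i ∈ Finset.range (n + 1), |C n i|) :=
        mul_le_mul (hr n) h₁ (norm_nonneg _) ((abs_nonneg _).trans (hr n))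
      _ = (1 / 2) ^ n := div_mul_cancel₀ _ (hM n).ne'
  refine ⟨?_, fun x => ?_⟩
  · refine contDiff_tsum_of_eventually (f := fun n => r n • g n)
      (fun n => (hg n).const_smul (r n)) (fun _ _ => hsum) fun i hi => ?_
    rw [Nat.cofinite_eq_atTop]
    filter_upwards [Filter.eventually_ge_atTop i] with n hn x
    exact key n i hi hn x
  · refine Summable.of_norm_bounded hsum fun n => ?_
    have := key n 0 (by simp) (Nat.zero_le n) x
    rwa [norm_iteratedFDeriv_zero] at this

/-- Near a point off `U` the factor `χ` vanishes identically, so the arbitrary values of `F` there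
do no harm. -/
theorem ContDiffOn.contDiff_mul_of_tsupport_subset {k : WithTop ℕ∞} {U : Set ℝ} (hU : IsOpen U)
    {χ F : ℝ → ℝ} (hχ : ContDiff ℝ k χ) (hs : tsupport χ ⊆ U) (hF : ContDiffOn ℝ k F U) :
    ContDiff ℝ k (fun x => χ x * F x) := by
  refine contDiff_iff_contDiffAt.2 fun x => ?_
  by_cases hx : x ∈ U
  · exact hχ.contDiffAt.mul (hF.contDiffAt (hU.mem_nhds hx))
  · have : (fun x => χ x * F x) =ᶠ[nhds x] fun _ => 0 := by
      filter_upwards [notMem_tsupport_iff_eventuallyEq.1 fun h => hx (hs h)] with y hy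
      simp [hy]
    exact contDiffAt_const.congr_of_eventuallyEq this

/-! ### Complements and fractions in `C^k(U)` -/

namespace CkRing

variable {k : ℕ∞} {U : Set ℝ}

theorem ext_iff_forall {f g : CkRing k U} : f = g ↔ ∀ x : U, f.1 x = g.1 x :=
  Subtype.ext_iff.trans funext_iff

/-- The restriction to `U` of a `C^k` function on the line. -/
def restrict (F : ℝ → ℝ) (hF : ContDiff ℝ k F) : CkRing k U :=
  ⟨fun x => F x, F, hF.contDiffOn, fun _ => rfl⟩

theorem exists_complement (f : CkRing k U) (hU : IsOpen U) :
    ∃ g, f * g = 0 ∧ f + g ∈ nonZeroDivisors (CkRing k U) := by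
  obtain ⟨F, hF, hfF⟩ := f.2
  obtain ⟨G, hGs, hG, -⟩ := (isClosed_closure (s := {x | x ∈ U ∧ F x ≠ 0})).isOpen_compl
    |>.exists_contDiff_support_eq (n := k)
  have hGx (x : ℝ) : G x ≠ 0 ↔ x ∉ closure {x | x ∈ U ∧ F x ≠ 0} := by
    rw [← Function.mem_support, hGs, Set.mem_compl_iff]
  have hFG (x : ℝ) (hx : x ∈ U) : F x = 0 ∨ G x = 0 := by
    by_contra! h
    exact (hGx x).1 h.2 (subset_closure ⟨hx, h.1⟩)
  refine ⟨restrict G hG, ext_iff_forall.2 fun x => ?_, mem_nonZeroDivisors_iff_right.2 fun c hc =>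
    ext_iff_forall.2 fun x => ?_⟩
  · change f.1 x * G x = 0
    rw [hfF]
    exact mul_eq_zero.2 (hFG x x.2)
  · obtain ⟨H, hH, hcH⟩ := c.2
    rw [hcH]
    change H x = 0
    by_contra hx
    have hcont : ContinuousAt H x := hH.continuousOn.continuousAt (hU.mem_nhds x.2)
    -- Where `c` is nonzero, `F + G = 0` and `F * G = 0`, so both vanish near `x`. But if `F`
    -- vanishes near `x`, then `x` lies in the support of `G`.
    have hz : ∀ᶠ y in nhds (x : ℝ), y ∈ U ∧ F y = 0 ∧ G y = 0 := by
      filter_upwards [hcont.eventually_ne hx, hU.mem_nhds x.2] with y hy hyU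
      have h : c.1 ⟨y, hyU⟩ * (f.1 ⟨y, hyU⟩ + G y) = 0 := ext_iff_forall.1 hc ⟨y, hyU⟩
      rw [hcH, hfF] at h
      have h' := (mul_eq_zero.1 h).resolve_left hy
      refine ⟨hyU, ?_⟩
      rcases hFG y hyU with h0 | h0 <;> simp_all
    refine (hGx x).2 (fun hcl => ?_) hz.self_of_nhds.2.2
    obtain ⟨y, ⟨-, hy, -⟩, -, hy'⟩ := mem_closure_iff_nhds.1 hcl _ hz
    exact hy' hy

/-- A homomorphism from a dense ideal `D` to `C^k(U)` is multiplication by a fraction `p / q`, where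
`q` is a weighted sum of squares `d ^ 2`, cut off by bump functions, with `d` in `D`. -/
theorem exists_fraction (hU : IsOpen U) (f : DenseHom (CkRing k U)) :
    ∃ q ∈ nonZeroDivisors (CkRing k U), ∃ p : CkRing k U,
      ∀ (d : CkRing k U) (hd : d ∈ f.dom), q * f.hom ⟨d, hd⟩ = p * d := by
  choose ext hext heq using fun a : CkRing k U => a.2
  let ι := {i : (ℝ → ℝ) × f.dom // tsupport i.1 ⊆ U ∧ HasCompactSupport i.1 ∧
    ContDiff ℝ k i.1 ∧ ∀ x, 0 ≤ i.1 x}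
  -- For `i = (χ, d)`, the choices `a = d` and `a = f.hom d` give the summands of `q` and of `p`.
  let term (i : ι) (a : CkRing k U) (x : ℝ) : ℝ := i.1.1 x * (ext i.1.2 x * ext a x)
  have hterm (i : ι) (a : CkRing k U) : ContDiff ℝ k (term i a) :=
    ((hext i.1.2).mul (hext a)).contDiff_mul_of_tsupport_subset hU i.2.2.2.1 i.2.1
  have hsupp (i : ι) (a : CkRing k U) : HasCompactSupport (term i a) := i.2.2.1.mul_right
  have hnonneg (i : ι) (x : ℝ) : 0 ≤ term i i.1.2 x :=
    mul_nonneg (i.2.2.2.2 x) (mul_self_nonneg _)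
  have : Nonempty ι := ⟨⟨(0, 0), by simp [tsupport], HasCompactSupport.zero, contDiff_const,
    fun _ => le_rfl⟩⟩
  -- Lindelöf: countably many of these supports have the same union. Extra indices in the
  -- enumeration `s` are harmless, as the summands of `q` are nonnegative.
  obtain ⟨T, hT, hcover⟩ := TopologicalSpace.isOpen_iUnion_countable
    (fun i : ι => Function.support (term i i.1.2)) fun i => (hterm i _).continuous.isOpen_support
  obtain ⟨s, hs⟩ := Set.countable_iff_exists_subset_range.1 hT
  obtain ⟨R, hR, hR'⟩ := exists_pos_forall_contDiff_tsum (fun n => hterm (s n) (s n).1.2)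
    fun n => hsupp _ _
  obtain ⟨S, hS, hS'⟩ := exists_pos_forall_contDiff_tsum (fun n => hterm (s n) (f.hom (s n).1.2))
    fun n => hsupp _ _
  -- The minimum serves as a common weight for `p` and `q`, as `q * f d = p * d` requires.
  have hr (n : ℕ) : 0 < min (R n) (S n) := lt_min (hR n) (hS n)
  obtain ⟨hq, hqs⟩ := hR' (fun n => min (R n) (S n)) fun n => by
    rw [abs_of_pos (hr n)]; exact min_le_left _ _
  obtain ⟨hp, -⟩ := hS' (fun n => min (R n) (S n)) fun n => by
    rw [abs_of_pos (hr n)]; exact min_le_right _ _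
  refine ⟨restrict _ hq, mem_nonZeroDivisors_iff_right.2 fun b hb => f.dense b fun d hd =>
    ext_iff_forall.2 fun x => ?_, restrict _ hp, fun d hd => ext_iff_forall.2 fun x => ?_⟩
  · change b.1 x * d.1 x = 0
    by_cases hdx : d.1 x = 0
    · rw [hdx, mul_zero]
    have hbx : b.1 x * ∑' n, min (R n) (S n) * term (s n) (s n).1.2 x = 0 :=
      ext_iff_forall.1 hb x
    refine mul_eq_zero_of_left ((mul_eq_zero.1 hbx).resolve_right ?_) _
    -- A bump with `χ x = 1` puts `x` in the support of the term of `(χ, d)`, hence in that of some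
    -- enumerated term, so `q x > 0`.
    obtain ⟨χ, h₁, h₂, h₃, h₄, h₅⟩ := exists_contDiff_tsupport_subset (n := k) (hU.mem_nhds x.2)
    let i : ι := ⟨(χ, ⟨d, hd⟩), h₁, h₂, h₃, fun y => (h₄ ⟨y, rfl⟩).1⟩
    have hi : (x : ℝ) ∈ ⋃ i : ι, Function.support (term i i.1.2) := by
      refine Set.mem_iUnion.2 ⟨i, ?_⟩
      change χ x * (ext d x * ext d x) ≠ 0
      rw [h₅, ← heq, one_mul]
      exact mul_self_ne_zero.2 hdx
    rw [← hcover] at hi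
    obtain ⟨j, hj, hjx⟩ := Set.mem_iUnion₂.1 hi
    obtain ⟨n, rfl⟩ := hs hj
    exact ((hqs x).tsum_pos (fun n => mul_nonneg (hr n).le (hnonneg (s n) x)) n
      (mul_pos (hr n) ((hnonneg (s n) x).lt_of_ne' hjx))).ne'
  · change (∑' n, min (R n) (S n) * term (s n) (s n).1.2 x) * (f.hom ⟨d, hd⟩).1 x =
      (∑' n, min (R n) (S n) * term (s n) (f.hom (s n).1.2) x) * d.1 x
    rw [← tsum_mul_right, ← tsum_mul_right]
    refine tsum_congr fun n => ?_
    -- By linearity both sides are the value of `f` at the product of `d` and `dₙ`.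
    have hcomm : d * f.hom (s n).1.2 = (s n).1.2 * f.hom ⟨d, hd⟩ := by
      rw [← smul_eq_mul, ← smul_eq_mul, ← map_smul, ← map_smul]
      exact congrArg f.hom (Subtype.ext (mul_comm _ _))
    have hx : d.1 x * (f.hom (s n).1.2).1 x = (s n).1.2.1.1 x * (f.hom ⟨d, hd⟩).1 x :=
      ext_iff_forall.1 hcomm x
    simp only [term, ← heq]
    linear_combination -(min (R n) (S n) * (s n).1.1 x * (s n).1.2.1.1 x) * hx

end CkRing

/-- For `A = C^k(U)`, the classical ring of quotients `Q_cl(A)` (the localization of `A` at all its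
non-zero-divisors), the complete ring of quotients `Q(A)` and the maximal flat epimorphic
extension `Q_tot(A)` coincide as extensions of `A`, and this ring is von Neumann regular. -/
theorem corollary3p4 (k : ℕ∞) (U : Set ℝ) (hU : IsOpen U) (hne : U.Nonempty) :
    Nonempty (FractionRing (CkRing k U) ≃ₐ[CkRing k U] CompleteQuotientRing (CkRing k U)) ∧
    IsMaximalFlatEpimorphicExtension
      (algebraMap (CkRing k U) (FractionRing (CkRing k U))) ∧
    IsMaximalFlatEpimorphicExtension
      (algebraMap (CkRing k U) (CompleteQuotientRing (CkRing k U))) ∧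
    IsVonNeumannRegular (FractionRing (CkRing k U)) := by
  have : IsFractionRing (CkRing k U) (CompleteQuotientRing (CkRing k U)) :=
    CompleteQuotientRing.isFractionRing (CkRing.exists_fraction hU)
  have hcl : IsVonNeumannRegular (FractionRing (CkRing k U)) :=
    IsFractionRing.isVonNeumannRegular (A := CkRing k U) fun f => CkRing.exists_complement f hU
  have hQ : IsVonNeumannRegular (CompleteQuotientRing (CkRing k U)) :=
    IsFractionRing.isVonNeumannRegular (A := CkRing k U) fun f => CkRing.exists_complement f hU
  exact ⟨⟨FractionRing.algEquiv _ _⟩, isMaximalFlatEpimorphicExtension_of_isVonNeumannRegular hcl,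
    isMaximalFlatEpimorphicExtension_of_isVonNeumannRegular hQ, hcl⟩
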